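/- Let $\mathcal{A}$ be either a locally noetherian Grothendieck category (a Grothendieck category with a generating set consisting of noetherian objects) or a noetherian abelian category (a skeletally small abelian category all of whose objects are noetherian). *Atoms.* A nonzero object $H\in\mathcal{A}$ is monoform if there are no subobjects $0\neq L'\subsetneq L\subseteq H$ and $0\neq N\subseteq H$ with $L/L'\cong N$. Two monoform objects are atom-equivalent if they have isomorphic nonzero subobjects; this is an equivalence relation, and the set of its classes, called atoms, is the atom spectrum $\operatorname{ASpec}\mathcal{A}$. Fix a monoform representative of every atom. *Extension groups.* For an integer $i\geq 0$, an atom $\alpha$ with fixed representative $H$ and an object $N$, put $$\operatorname{Ext}^i_{\mathcal{A}}(\alpha,N):=\varinjlim_{0\neq H'\subseteq H}\operatorname{Ext}^i_{\mathcal{A}}(H',N),$$ and for an atom $\beta$ with fixed representative $K$ put $$\operatorname{Ext}^i_{\mathcal{A}}(\alpha,\beta):=\varprojlim_{0\neq K'\subseteq K}\operatorname{Ext}^i_{\mathcal{A}}(\alpha,K').$$ The latter inverse system is eventually constant if there is a nonzero subobject $K'\subseteq K$ such that for all nonzero subobjects $K_2\subseteq K_1\subseteq K'$ the canonical map $\operatorname{Ext}^i_{\mathcal{A}}(\alpha,K_2)\to\operatorname{Ext}^i_{\mathcal{A}}(\alpha,K_1)$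 is bijective. Let $\operatorname{Const}_i(\alpha)$ be the set of atoms $\beta$ such that the inverse system defining $\operatorname{Ext}^i_{\mathcal{A}}(\alpha,\beta)$ is eventually constant and $\operatorname{Ext}^i_{\mathcal{A}}(\alpha,\beta)\neq 0$. In $\mathbb{Z}_{\geq 0}\cup\{\infty\}$, define $$\operatorname{proj.dim}\alpha:=\sup\{i\geq 0\mid \operatorname{Ext}^i_{\mathcal{A}}(\alpha,-)\neq 0\},\qquad \operatorname{cproj.dim}\alpha:=\sup\{i\geq 0\mid \operatorname{Const}_i(\alpha)\neq\emptyset\}.$$ *Krull-Gabriel dimension.* For $\lambda=-1$ and ordinals $\lambda$, define full subcategories $\mathcal{A}_\lambda\subseteq\mathcal{A}$ inductively. $\mathcal{A}_{-1}$ consists of the zero objects. If $\mathcal{A}$ is a locally noetherian Grothendieck category, $\mathcal{A}_{\lambda+1}$ is the smallest localizing subcategory (Serre subcategory closed under direct sums) containing all objects sent to objects of finite length by the canonical functor $\mathcal{A}\to\mathcal{A}/\mathcal{A}_\lambda$, and for a limit ordinal $\lambda$, $\mathcal{A}_\lambda$ is the smallest localizing subcategory containing $\mathcal{A}_\mu$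 for all $\mu<\lambda$. If $\mathcal{A}$ is a noetherian abelian category, $\mathcal{A}_{\lambda+1}$ consists of all objects sent to objects of finite length by $\mathcal{A}\to\mathcal{A}/\mathcal{A}_\lambda$, and $\mathcal{A}_\lambda=\bigcup_{\mu<\lambda}\mathcal{A}_\mu$ for a limit ordinal $\lambda$. Then $\operatorname{KGdim}\mathcal{A}$ is the least $\lambda$ with $\mathcal{A}_\lambda=\mathcal{A}$. **Theorem.** Let $\alpha\in\operatorname{ASpec}\mathcal{A}$ be an atom. Then $\operatorname{KGdim}\mathcal{A}$ exists and is an ordinal (that is, not $-1$), and $$\operatorname{proj.dim}\alpha\leq\operatorname{cproj.dim}\alpha+\operatorname{KGdim}\mathcal{A},$$ where an infinite ordinal $\operatorname{KGdim}\mathcal{A}$ is read as $\infty$. -/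

import Mathlib

open CategoryTheory CategoryTheory.Limits CategoryTheory.Abelian

universe w v u

/-! ### Monoform objects and the atom spectrum -/

namespace AtomSpectrum

section Atoms

variable {C : Type u} [Category.{v} C] [Abelian C]

/-- A nonzero object `H` is monoform if there are no subobjects `0 ≠ L' ⊊ L ⊆ H` and
`0 ≠ N ⊆ H` with `L / L' ≅ N`. -/
structure Monoform (H : C) : Prop where
  not_isZero : ¬ IsZero H
  not_iso : ∀ (L' L N : Subobject H) (h : L' < L), L' ≠ ⊥ → N ≠ ⊥ →
    IsEmpty (cokernel (Subobject.ofLE L' L h.le) ≅ (N : C))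

/-- Two objects are atom-equivalent if they have isomorphic nonzero subobjects. -/
def AtomEquivalent (H₁ H₂ : C) : Prop :=
  ∃ (L₁ : Subobject H₁) (L₂ : Subobject H₂), L₁ ≠ ⊥ ∧ L₂ ≠ ⊥ ∧ Nonempty ((L₁ : C) ≅ (L₂ : C))

theorem subobject_ne_bot_iff {H : C} (L : Subobject H) : L ≠ ⊥ ↔ ¬ IsZero (L : C) := by
  rw [not_iff_not]
  constructor
  · rintro rfl
    exact (isZero_zero C).of_iso Subobject.botCoeIsoZero
  · intro h
    rw [← Subobject.mk_arrow L, Subobject.mk_eq_bot_iff_zero]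
    exact h.eq_of_src _ _

/-- Any two nonzero subobjects of a monoform object have nonzero intersection. -/
theorem Monoform.inf_ne_bot {H : C} (hH : Monoform H) {L M : Subobject H}
    (hL : L ≠ ⊥) (hM : M ≠ ⊥) : L ⊓ M ≠ ⊥ := by
  intro h
  have hlt : L < L ⊔ M := by
    refine lt_of_le_of_ne le_sup_left fun e => hM ?_
    have : M ≤ L := by rw [e]; exact le_sup_right
    rwa [inf_eq_right.2 this] at h
  let g : (M : C) ⟶ cokernel (Subobject.ofLE L (L ⊔ M) hlt.le) :=
    Subobject.ofLE M (L ⊔ M) le_sup_right ≫ cokernel.π _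
  have hmono : Mono g := by
    refine Preadditive.mono_of_cancel_zero _ fun {T} t ht => ?_
    let k := (Abelian.monoIsKernelOfCokernel _
      (cokernelIsCokernel (Subobject.ofLE L (L ⊔ M) hlt.le))).lift
        (KernelFork.ofι (t ≫ Subobject.ofLE M (L ⊔ M) le_sup_right) (by simpa [g] using ht))
    have hk : k ≫ Subobject.ofLE L (L ⊔ M) hlt.le =
        t ≫ Subobject.ofLE M (L ⊔ M) le_sup_right :=
      (Abelian.monoIsKernelOfCokernel _
        (cokernelIsCokernel (Subobject.ofLE L (L ⊔ M) hlt.le))).fac _ WalkingParallelPair.zero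
    have e : k ≫ L.arrow = t ≫ M.arrow := by
      have := congrArg (· ≫ (L ⊔ M).arrow) hk
      simpa using this
    have hf : (L ⊓ M).Factors (t ≫ M.arrow) := by
      rw [Subobject.inf_factors]
      exact ⟨by rw [← e]; exact Subobject.factors_comp_arrow _,
        Subobject.factors_comp_arrow _⟩
    rw [h, Subobject.bot_factors_iff_zero] at hf
    exact zero_of_comp_mono _ hf
  have hepi : Epi g := by
    refine Preadditive.epi_of_cancel_zero _ fun {Z} p hp => ?_
    let q := cokernel.π (Subobject.ofLE L (L ⊔ M) hlt.le) ≫ p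
    have hqL : Subobject.ofLE L (L ⊔ M) hlt.le ≫ q = 0 := by simp [q]
    have hqM : Subobject.ofLE M (L ⊔ M) le_sup_right ≫ q = 0 := by simpa [q, g] using hp
    have hle : L ⊔ M ≤ Subobject.mk (kernel.ι q ≫ (L ⊔ M).arrow) := by
      refine sup_le ?_ ?_
      · exact Subobject.le_mk_of_comm (kernel.lift q _ hqL) (by simp)
      · exact Subobject.le_mk_of_comm (kernel.lift q _ hqM) (by simp)
    have hq : q = 0 := by
      let r := Subobject.ofLEMk _ _ hle
      have hr : r ≫ kernel.ι q = 𝟙 _ := by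
        rw [← cancel_mono (L ⊔ M).arrow]
        simp [r]
      rw [← Category.id_comp q, ← hr, Category.assoc, kernel.condition, comp_zero]
    exact zero_of_epi_comp (cokernel.π (Subobject.ofLE L (L ⊔ M) hlt.le)) hq
  have : IsIso g := isIso_of_mono_of_epi g
  exact (hH.not_iso L (L ⊔ M) M hlt hL hM).false (asIso g).symm

theorem atomEquivalent_iff {H₁ H₂ : C} : AtomEquivalent H₁ H₂ ↔
    ∃ (K : C) (f : K ⟶ H₁) (g : K ⟶ H₂), ¬ IsZero K ∧ Mono f ∧ Mono g := by
  constructor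
  · rintro ⟨L₁, L₂, h₁, -, ⟨e⟩⟩
    exact ⟨_, L₁.arrow, e.hom ≫ L₂.arrow, (subobject_ne_bot_iff _).1 h₁, inferInstance,
      inferInstance⟩
  · rintro ⟨K, f, g, hK, hf, hg⟩
    refine ⟨Subobject.mk f, Subobject.mk g, ?_, ?_,
      ⟨Subobject.underlyingIso f ≪≫ (Subobject.underlyingIso g).symm⟩⟩
    · exact (subobject_ne_bot_iff _).2 fun h => hK (h.of_iso (Subobject.underlyingIso f).symm)
    · exact (subobject_ne_bot_iff _).2 fun h => hK (h.of_iso (Subobject.underlyingIso g).symm)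

variable (C) in
/-- Atom-equivalence on the monoform objects. -/
def atomSetoid : Setoid {H : C // Monoform H} where
  r H₁ H₂ := AtomEquivalent H₁.1 H₂.1
  iseqv :=
    { refl := fun H => atomEquivalent_iff.2
        ⟨H.1, 𝟙 _, 𝟙 _, H.2.not_isZero, inferInstance, inferInstance⟩
      symm := by
        rintro _ _ ⟨L₁, L₂, h₁, h₂, ⟨e⟩⟩
        exact ⟨L₂, L₁, h₂, h₁, ⟨e.symm⟩⟩
      trans := by
        rintro H₁ H₂ H₃ ⟨L₁, L₂, -, h₂, ⟨e⟩⟩ ⟨M₂, M₃, k₂, -, ⟨e'⟩⟩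
        refine atomEquivalent_iff.2 ⟨((L₂ ⊓ M₂ : Subobject H₂.1) : C),
          Subobject.ofLE _ L₂ inf_le_left ≫ e.inv ≫ L₁.arrow,
          Subobject.ofLE _ M₂ inf_le_right ≫ e'.hom ≫ M₃.arrow,
          (subobject_ne_bot_iff _).1 (H₂.2.inf_ne_bot h₂ k₂), inferInstance, inferInstance⟩ }

variable (C) in
/-- The atom spectrum: monoform objects modulo atom-equivalence. -/
def ASpec : Type u := Quotient (atomSetoid C)

/-- The fixed monoform representative of an atom. -/
noncomputable def ASpec.rep (α : ASpec C) : C := (Quotient.out α).1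

/-- The nonzero subobjects of an object, ordered by inclusion. -/
abbrev NonzeroSubobject (H : C) : Type max u v := {L : Subobject H // L ≠ ⊥}

end Atoms

/-! ### Extension groups of atoms -/

section Ext

variable {C : Type u} [Category.{v} C] [Abelian C] [HasExt.{w} C]

/-- The map `Ext^i(H₁, N) → Ext^i(H₂, N)` induced by an inclusion `H₂ ≤ H₁` of subobjects. -/
noncomputable def extRestrict (i : ℕ) {H : C} (N : C) (H₁ H₂ : (NonzeroSubobject H)ᵒᵈ)
    (h : H₁ ≤ H₂) :
    Ext ((OrderDual.ofDual H₁).1 : C) N i →+ Ext ((OrderDual.ofDual H₂).1 : C) N i :=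
  (Ext.mk₀ (Subobject.ofLE (OrderDual.ofDual H₂).1 (OrderDual.ofDual H₁).1 h)).precomp N
    (zero_add i)

open scoped Classical in
/-- `Ext^i(α, N)`: the direct limit of `Ext^i(H', N)` over the nonzero subobjects `H'` of the
fixed representative of `α`, ordered by reverse inclusion. -/
abbrev AtomExt (i : ℕ) (α : ASpec C) (N : C) : Type max u v w :=
  AddCommGroup.DirectLimit (ι := (NonzeroSubobject α.rep)ᵒᵈ)
    (fun H' => Ext ((OrderDual.ofDual H').1 : C) N i) (extRestrict i N)

open scoped Classical in
/-- The map `Ext^i(α, N) → Ext^i(α, N')` induced by a morphism `N ⟶ N'`. -/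
noncomputable def AtomExt.map (i : ℕ) (α : ASpec C) {N N' : C} (f : N ⟶ N') :
    AtomExt i α N →+ AtomExt i α N' :=
  AddCommGroup.DirectLimit.map
    (fun H' => (Ext.mk₀ f).postcomp ((OrderDual.ofDual H').1 : C) (add_zero i)) (by
      intro H₁ H₂ h
      ext x
      simp [extRestrict])

/-- `Ext^i(α, β)`: the inverse limit of `Ext^i(α, H')` over the nonzero subobjects `H'` of the
fixed representative of `β`, realised as the group of compatible families. -/
def atomExtAtom (i : ℕ) (α β : ASpec C) :
    AddSubgroup (∀ H' : NonzeroSubobject β.rep, AtomExt i α (H'.1 : C)) where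
  carrier := {x | ∀ (H₂ H₁ : NonzeroSubobject β.rep) (h : H₂ ≤ H₁),
    AtomExt.map i α (Subobject.ofLE H₂.1 H₁.1 h) (x H₂) = x H₁}
  zero_mem' := by simp
  add_mem' := by
    intro x y hx hy H₂ H₁ h
    simp [hx H₂ H₁ h, hy H₂ H₁ h]
  neg_mem' := by
    intro x hx H₂ H₁ h
    simp [hx H₂ H₁ h]

/-- The inverse system defining `Ext^i(α, β)` is eventually constant. -/
def EventuallyConstant (i : ℕ) (α β : ASpec C) : Prop :=
  ∃ H' : NonzeroSubobject β.rep, ∀ (H₂ H₁ : NonzeroSubobject β.rep) (h : H₂ ≤ H₁), H₁ ≤ H' →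
    Function.Bijective (AtomExt.map i α (Subobject.ofLE H₂.1 H₁.1 h))

/-- The set of atoms `β` such that the inverse system defining `Ext^i(α, β)` is eventually
constant and `Ext^i(α, β) ≠ 0`. -/
def ConstSet (i : ℕ) (α : ASpec C) : Set (ASpec C) :=
  {β | EventuallyConstant i α β ∧ Nontrivial (atomExtAtom i α β)}

/-- `proj.dim α`, the supremum of all `i` such that the functor `Ext^i(α, -)` is nonzero. -/
noncomputable def projDim (α : ASpec C) : ℕ∞ :=
  ⨆ i ∈ {i : ℕ | ∃ N : C, Nontrivial (AtomExt i α N)}, (i : ℕ∞)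

/-- `cproj.dim α`, the supremum of all `i` such that `ConstSet i α` is nonempty. -/
noncomputable def cprojDim (α : ASpec C) : ℕ∞ :=
  ⨆ i ∈ {i : ℕ | (ConstSet i α).Nonempty}, (i : ℕ∞)

end Ext

/-! ### Krull-Gabriel dimension -/

section KrullGabriel

variable {C : Type u} [Category.{v} C] [Abelian C]

/-- The morphisms with kernel and cokernel in `P`. For a Serre subcategory `P`, this is Mathlib's
`P.isoModSerre`, and inverting it gives the quotient category `C / P`. -/
def isoMod (P : ObjectProperty C) : MorphismProperty C :=
  fun _ _ f => P (kernel f) ∧ P (cokernel f)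

/-- An object has finite length if it is noetherian and artinian. -/
def HasFiniteLength {D : Type*} [Category* D] (X : D) : Prop :=
  IsNoetherianObject X ∧ IsArtinianObject X

/-- The objects that the canonical functor `C ⥤ C / P` sends to objects of finite length. -/
def finiteLengthMod (P : ObjectProperty C) : ObjectProperty C :=
  fun M => HasFiniteLength ((isoMod P).Q.obj M)

/-- A localizing subcategory of a Grothendieck category: a Serre subcategory closed under
(small) direct sums. -/
structure IsLocalizing (P : ObjectProperty C) : Prop where
  isSerreClass : P.IsSerreClass
  isClosedUnderCoproducts : ∀ ι : Type v, P.IsClosedUnderColimitsOfShape (Discrete ι)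

/-- The smallest localizing subcategory containing all objects in `Q`. -/
def localizingClosure (Q : ObjectProperty C) : ObjectProperty C :=
  fun M => ∀ P : ObjectProperty C, IsLocalizing P → Q ≤ P → P M

variable (C) in
/-- The Gabriel filtration of a Grothendieck category at the ordinals `≥ 0`. -/
noncomputable def gabrielOrd (o : Ordinal.{v}) : ObjectProperty C :=
  Ordinal.limitRecOn o
    (localizingClosure (finiteLengthMod (IsZero (C := C))))
    (fun _ P => localizingClosure (finiteLengthMod P))
    (fun o _ P => localizingClosure (fun M => ∃ (o' : Ordinal.{v}) (h : o' < o), P o' h M))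

variable (C) in
/-- The Gabriel filtration of a Grothendieck category, where the index `⊥` stands for `-1`. -/
noncomputable def gabriel : WithBot Ordinal.{v} → ObjectProperty C
  | ⊥ => IsZero
  | (o : Ordinal.{v}) => gabrielOrd C o

variable (C) in
/-- The filtration of a noetherian abelian category at the ordinals `≥ 0`. -/
noncomputable def noethGabrielOrd (o : Ordinal.{v}) : ObjectProperty C :=
  Ordinal.limitRecOn o
    (finiteLengthMod (IsZero (C := C)))
    (fun _ P => finiteLengthMod P)
    (fun o _ P => fun M => ∃ (o' : Ordinal.{v}) (h : o' < o), P o' h M)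

variable (C) in
/-- The filtration of a noetherian abelian category, where the index `⊥` stands for `-1`. -/
noncomputable def noethGabriel : WithBot Ordinal.{v} → ObjectProperty C
  | ⊥ => IsZero
  | (o : Ordinal.{v}) => noethGabrielOrd C o

variable (C) in
/-- The Krull-Gabriel dimension of the Grothendieck category `C` exists and is `d`. -/
def IsKGDim (d : WithBot Ordinal.{v}) : Prop :=
  IsLeast {l : WithBot Ordinal.{v} | ∀ M : C, gabriel C l M} d

variable (C) in
/-- The Krull-Gabriel dimension of the noetherian abelian category `C` exists and is `d`. -/
def IsNoethKGDim (d : WithBot Ordinal.{v}) : Prop :=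
  IsLeast {l : WithBot Ordinal.{v} | ∀ M : C, noethGabriel C l M} d

variable (C) in
/-- `C` has a (small) generating set consisting of noetherian objects. -/
def HasNoetherianGenerators : Prop :=
  ∃ (ι : Type v) (U : ι → C), (∀ i, IsNoetherianObject (U i)) ∧
    (ObjectProperty.ofObj U).IsSeparating

/-- An ordinal as an element of `ℕ ∪ {∞}`; all infinite ordinals become `∞`. -/
noncomputable def ordinalToENat (o : Ordinal.{v}) : ℕ∞ := Cardinal.toENat o.card

end KrullGabriel

end AtomSpectrum

/-! If `cprojDim α` or the Krull-Gabriel dimension is infinite, the bound is trivial. Otherwise let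
`cprojDim α` be `c`. By induction on `k`, `Ext^i(α, -)` vanishes on the `k`-th member of the
filtration for `i > c + k`.

For the induction step, let `P` be a Serre subcategory on which `Ext^i(α, -)` vanishes for `i ≥ n`,
where `n ≥ c`, and let `L` be critical for `P`. The quotients of `L` by nonzero subobjects lie in
`P`, while no nonzero subobject of `L` does, so `L` is monoform and defines an atom `β`. By the long
exact sequence, inclusions of nonzero subobjects of `L` induce bijections on `Ext^i(α, -)` for `i >
n`. So the system of `β` is eventually constant with value `Ext^i(α, L)`, and this is zero because
`β` is not in `ConstSet i α` (`subsingleton_of_isCritical`). A noetherian object of finite length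
modulo `P` is built by finitely many extensions from objects of `P` and critical objects, so
vanishing passes to it (`subsingleton_of_finiteLengthMod`).

In the Grothendieck case two facts reduce everything to noetherian objects: a noetherian object in
the localizing closure of a Serre class already lies in that class (`prop_of_localizingClosure`),
and classes in `Ext^i(α, N)` come from noetherian subobjects of `N`
(`subsingleton_of_isNoetherianObject`).

The dimension exists because a noetherian object outside `P` has a quotient that is simple modulo
`P` (`exists_finiteLengthMod_cokernel`). A filtration that never stopped would embed the ordinals
into a small set of such quotients. -/

namespace AtomSpectrum

/-! ### Chain conditions define Serre classes -/

section Subobjects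

variable {C : Type u} [Category.{v} C]

theorem le_of_factors {X : C} {L M : Subobject X} (h : M.Factors L.arrow) : L ≤ M :=
  Subobject.le_of_comm (M.factorThru L.arrow h) (Subobject.factorThru_arrow _ _ _)

theorem hasFiniteLength_iff (X : C) :
    HasFiniteLength X ↔ isNoetherianObject X ∧ isArtinianObject X :=
  and_congr (ObjectProperty.is_iff _ _) (ObjectProperty.is_iff _ _)


variable [Abelian C]

theorem factors_iff_comp_eq_zero {B X : C} {L : Subobject X} {h : B ⟶ X} :
    L.Factors h ↔ h ≫ cokernel.π L.arrow = 0 := by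
  constructor
  · intro hf
    rw [← Subobject.factorThru_arrow L _ hf, Category.assoc, cokernel.condition, comp_zero]
  · intro h0
    have e : Abelian.monoLift L.arrow h h0 ≫ L.arrow = h := Abelian.monoLift_comp _ _ _
    rw [← e]
    exact Subobject.factors_comp_arrow _

theorem factors_of_epi_comp {A B X : C} {L : Subobject X} (p : A ⟶ B) [Epi p] {h : B ⟶ X}
    (hf : L.Factors (p ≫ h)) : L.Factors h := by
  rw [factors_iff_comp_eq_zero] at hf ⊢
  rwa [← cancel_epi p, comp_zero, ← Category.assoc]

theorem pullback_factors_iff {X Y T : C} (p : X ⟶ Y) (L : Subobject Y) (t : T ⟶ X) :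
    ((Subobject.pullback p).obj L).Factors t ↔ L.Factors (t ≫ p) := by
  have sq := Subobject.isPullback p L
  constructor
  · intro h
    rw [← Subobject.factorThru_arrow _ _ h, Category.assoc, ← sq.w, ← Category.assoc]
    exact Subobject.factors_comp_arrow _
  · intro h
    have e := sq.lift_snd (L.factorThru _ h) t (Subobject.factorThru_arrow _ _ h)
    rw [← e]
    exact Subobject.factors_comp_arrow _

theorem pullback_strictMono_of_epi {X Y : C} (p : X ⟶ Y) [Epi p] :
    StrictMono (Subobject.pullback p).obj := by
  refine (Subobject.pullback p).monotone.strictMono_of_injective ?_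
  have key : ∀ L M : Subobject Y, (Subobject.pullback p).obj L = (Subobject.pullback p).obj M →
      L ≤ M := by
    intro L M h
    obtain ⟨A, π, _, x, hx⟩ := surjective_up_to_refinements_of_epi p L.arrow
    refine le_of_factors (factors_of_epi_comp π ?_)
    rw [hx, ← pullback_factors_iff, ← h, pullback_factors_iff, ← hx]
    exact Subobject.factors_comp_arrow _
  exact fun L M h => le_antisymm (key L M h) (key M L h.symm)

/-- The preimage in `S.X₁` and the image in `S.X₃` of a subobject of the middle term of `S`. -/
noncomputable def subobjectProd (S : ShortComplex C) (L : Subobject S.X₂) :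
    Subobject S.X₁ × Subobject S.X₃ :=
  ((Subobject.pullback S.f).obj L, imageSubobject (L.arrow ≫ S.g))

/-- Let `L ≤ M` have the same preimage and image. An element of `M` differs from one of `L` by an
element of `S.X₁`, which lies in `M`, hence in `L`. Well-foundedness thus passes from the ends of a
short exact sequence to its middle. -/
theorem subobjectProd_strictMono {S : ShortComplex C} (hS : S.ShortExact) :
    StrictMono (subobjectProd S) := by
  have hmono : Monotone (subobjectProd S) := by
    intro L M h
    refine ⟨(Subobject.pullback S.f).monotone h, ?_⟩
    change imageSubobject (L.arrow ≫ S.g) ≤ imageSubobject (M.arrow ≫ S.g)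
    refine imageSubobject_le _ (Subobject.ofLE L M h ≫ factorThruImageSubobject (M.arrow ≫ S.g)) ?_
    simp
  intro L M h
  refine lt_of_le_of_ne (hmono h.le) fun e => h.not_ge ?_
  have e₁ : (Subobject.pullback S.f).obj L = (Subobject.pullback S.f).obj M := congrArg Prod.fst e
  have e₂ : imageSubobject (L.arrow ≫ S.g) = imageSubobject (M.arrow ≫ S.g) :=
    congrArg Prod.snd e
  have hf : (imageSubobject (L.arrow ≫ S.g)).Factors (M.arrow ≫ S.g) := by
    rw [e₂]
    simpa using imageSubobject_factors_comp_self (M.arrow ≫ S.g) (𝟙 _)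
  obtain ⟨A, π, _, x, hx⟩ := surjective_up_to_refinements_of_epi
    (factorThruImageSubobject (L.arrow ≫ S.g)) (Subobject.factorThru _ _ hf)
  have hx' : (π ≫ M.arrow) ≫ S.g = (x ≫ L.arrow) ≫ S.g := by
    have := congrArg (· ≫ (imageSubobject (L.arrow ≫ S.g)).arrow) hx
    simpa using this
  have h0 : (π ≫ M.arrow - x ≫ L.arrow) ≫ S.g = 0 := by
    rw [Preadditive.sub_comp, hx', sub_self]
  obtain ⟨B, ρ, _, y, hy⟩ := hS.exact.exact_up_to_refinements _ h0
  refine le_of_factors (factors_of_epi_comp (ρ ≫ π) ?_)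
  have hM : M.Factors (y ≫ S.f) := by
    rw [← hy, Preadditive.comp_sub, ← Category.assoc, ← Subobject.ofLE_arrow h.le,
      ← Category.assoc, ← Category.assoc, ← Preadditive.sub_comp]
    exact Subobject.factors_comp_arrow _
  have hL : L.Factors (y ≫ S.f) := by
    rwa [← pullback_factors_iff, e₁, pullback_factors_iff]
  have e₃ : (ρ ≫ π) ≫ M.arrow = L.factorThru _ hL ≫ L.arrow + (ρ ≫ x) ≫ L.arrow := by
    rw [Subobject.factorThru_arrow, ← hy, Preadditive.comp_sub]
    simp
  rw [e₃, ← Preadditive.add_comp]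
  exact Subobject.factors_comp_arrow _

instance isNoetherianObject_isSerreClass : (isNoetherianObject (C := C)).IsSerreClass where
  prop_of_epi f _ h := by
    have : WellFoundedGT (Subobject _) := h
    exact (pullback_strictMono_of_epi f).wellFoundedGT
  prop_X₂_of_shortExact hS h₁ h₃ := by
    have : WellFoundedGT (Subobject _) := h₁
    have : WellFoundedGT (Subobject _) := h₃
    exact (subobjectProd_strictMono hS).wellFoundedGT

instance isArtinianObject_isSerreClass : (isArtinianObject (C := C)).IsSerreClass where
  prop_of_epi f _ h := by
    have : WellFoundedLT (Subobject _) := h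
    exact (pullback_strictMono_of_epi f).wellFoundedLT
  prop_X₂_of_shortExact hS h₁ h₃ := by
    have : WellFoundedLT (Subobject _) := h₁
    have : WellFoundedLT (Subobject _) := h₃
    exact (subobjectProd_strictMono hS).wellFoundedLT

instance hasFiniteLength_isSerreClass :
    ObjectProperty.IsSerreClass (HasFiniteLength : C → Prop) where
  exists_zero := ⟨_, isZero_zero C, isNoetherianObject_of_isZero (isZero_zero C),
    isArtinianObject_of_isZero (isZero_zero C)⟩
  prop_of_mono f _ h := by
    rw [hasFiniteLength_iff] at h ⊢
    exact ⟨ObjectProperty.prop_of_mono _ f h.1, ObjectProperty.prop_of_mono _ f h.2⟩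
  prop_of_epi f _ h := by
    rw [hasFiniteLength_iff] at h ⊢
    exact ⟨ObjectProperty.prop_of_epi _ f h.1, ObjectProperty.prop_of_epi _ f h.2⟩
  prop_X₂_of_shortExact hS h₁ h₃ := by
    rw [hasFiniteLength_iff] at h₁ h₃ ⊢
    exact ⟨ObjectProperty.prop_X₂_of_shortExact _ hS h₁.1 h₃.1,
      ObjectProperty.prop_X₂_of_shortExact _ hS h₁.2 h₃.2⟩

end Subobjects

/-! ### Finite length modulo a Serre subcategory; critical objects -/

section Quotient

open ObjectProperty

variable {C : Type u} [Category.{v} C] [Abelian C] (P : ObjectProperty C) [P.IsSerreClass]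

/-- The quotient functor is exact, so it pulls Serre classes back to Serre classes. -/
instance finiteLengthMod_isSerreClass : (finiteLengthMod P).IsSerreClass := by
  let : Abelian P.isoModSerre.Localization :=
    SerreClassLocalization.abelian P.isoModSerre.Q P
  have : PreservesFiniteLimits P.isoModSerre.Q :=
    SerreClassLocalization.preservesFiniteLimits P.isoModSerre.Q P
  have : PreservesFiniteColimits P.isoModSerre.Q :=
    SerreClassLocalization.preservesFiniteColimits P.isoModSerre.Q P
  exact inferInstanceAs (ObjectProperty.IsSerreClass
    (ObjectProperty.inverseImage (HasFiniteLength : P.isoModSerre.Localization → Prop)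
      P.isoModSerre.Q))

theorem le_finiteLengthMod : P ≤ finiteLengthMod P := by
  let : Abelian P.isoModSerre.Localization :=
    SerreClassLocalization.abelian P.isoModSerre.Q P
  intro M hM
  have := (SerreClassLocalization.isZero_obj_iff P.isoModSerre.Q P M).2 hM
  exact ⟨isNoetherianObject_of_isZero this, isArtinianObject_of_isZero this⟩

/-- A nonzero object is critical for `P` if none of its nonzero subobjects is in `P` and all of its
proper quotients are. -/
structure IsCritical (L : C) : Prop where
  not_isZero : ¬ IsZero L
  not_prop {T : C} (f : T ⟶ L) [Mono f] : ¬ IsZero T → ¬ P T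
  prop_cokernel {T : C} (f : T ⟶ L) [Mono f] : ¬ IsZero T → P (cokernel f)

/-- If no nonzero subobject of `M` is in `P`, take one whose image in the quotient category is
minimal, by the artinian condition. Its nonzero subobjects have the same image, so their cokernels
die in the quotient. -/
theorem exists_prop_or_isCritical {M : C} (hM : finiteLengthMod P M) (h0 : ¬ IsZero M) :
    ∃ (L : C) (f : L ⟶ M), Mono f ∧ ¬ IsZero L ∧ (P L ∨ IsCritical P L) := by
  by_cases hP : ∃ (L : C) (f : L ⟶ M), Mono f ∧ ¬ IsZero L ∧ P L
  · obtain ⟨L, f, hf, hL, h⟩ := hP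
    exact ⟨L, f, hf, hL, Or.inl h⟩
  let : Abelian P.isoModSerre.Localization :=
    SerreClassLocalization.abelian P.isoModSerre.Q P
  have := SerreClassLocalization.preservesMonomorphisms P.isoModSerre.Q P
  push Not at hP
  have hart : IsArtinianObject (P.isoModSerre.Q.obj M) := hM.2
  let φ (L : NonzeroSubobject M) : Subobject (P.isoModSerre.Q.obj M) :=
    Subobject.mk (P.isoModSerre.Q.map L.1.arrow)
  have hne : Nonempty (NonzeroSubobject M) := ⟨⟨Subobject.mk (𝟙 M), by
    rw [subobject_ne_bot_iff]
    exact fun h => h0 (h.of_iso (Subobject.underlyingIso (𝟙 M)).symm)⟩⟩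
  obtain ⟨L, -, hL⟩ := WellFounded.has_min
    (InvImage.wf φ (wellFounded_lt (α := Subobject (P.isoModSerre.Q.obj M)))) Set.univ
    Set.univ_nonempty
  have hL0 := (subobject_ne_bot_iff _).1 L.2
  refine ⟨L.1, L.1.arrow, inferInstance, hL0, Or.inr ⟨hL0, ?_, ?_⟩⟩
  · intro T f _ hT
    exact hP T (f ≫ L.1.arrow) inferInstance hT
  · intro T f _ hT
    let T' : NonzeroSubobject M := ⟨Subobject.mk (f ≫ L.1.arrow), by
      rw [subobject_ne_bot_iff]
      exact fun h => hT (h.of_iso (Subobject.underlyingIso _).symm)⟩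
    have hle : φ T' ≤ φ L := by
      refine Subobject.mk_le_mk_of_comm
        (P.isoModSerre.Q.map ((Subobject.underlyingIso (f ≫ L.1.arrow)).hom ≫ f)) ?_
      rw [← Functor.map_comp]
      congr 1
      simp [T']
    have hge : φ L ≤ φ T' := by
      by_contra h
      exact hL T' (Set.mem_univ _) (lt_of_le_not_ge hle h)
    have e := Subobject.ofMkLEMk_comp hge
    have e' : P.isoModSerre.Q.map T'.1.arrow =
        P.isoModSerre.Q.map (Subobject.underlyingIso (f ≫ L.1.arrow)).hom ≫
          P.isoModSerre.Q.map f ≫ P.isoModSerre.Q.map L.1.arrow := by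
      rw [← Functor.map_comp, ← Functor.map_comp]
      congr 1
      simp [T']
    have hepi : Epi (P.isoModSerre.Q.map f) := by
      have e'' := congrArg (Subobject.ofMkLEMk _ _ hge ≫ ·) e'
      rw [e, ← Category.assoc, ← Category.assoc] at e''
      have := (cancel_mono (P.isoModSerre.Q.map L.1.arrow)).1
        (e''.symm.trans (Category.id_comp _).symm)
      have : IsSplitEpi (P.isoModSerre.Q.map f) := ⟨⟨_, this⟩⟩
      infer_instance
    exact (SerreClassLocalization.epi_map_iff P.isoModSerre.Q P f).1 hepi

/-- Such an `M` becomes zero or simple: by calculus of fractions, a subobject of its image comes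
from a morphism into `M`, which is either zero or epi modulo `P`. -/
theorem finiteLengthMod_of_prop_cokernel {M : C}
    (hM : ∀ {T : C} (f : T ⟶ M) [Mono f], ¬ IsZero T → P (cokernel f)) :
    finiteLengthMod P M := by
  let : Abelian P.isoModSerre.Localization :=
    SerreClassLocalization.abelian P.isoModSerre.Q P
  have key : ∀ S : Subobject (P.isoModSerre.Q.obj M), S = ⊥ ∨ S = ⊤ := by
    intro S
    have := Localization.essSurj P.isoModSerre.Q P.isoModSerre
    obtain ⟨φ, hφ⟩ := Localization.exists_rightFraction P.isoModSerre.Q P.isoModSerre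
      ((P.isoModSerre.Q.objObjPreimageIso (S : P.isoModSerre.Localization)).hom ≫ S.arrow)
    have hs : P.isoModSerre.Q.map φ.s ≫
        (P.isoModSerre.Q.objObjPreimageIso (S : P.isoModSerre.Localization)).hom ≫ S.arrow =
        P.isoModSerre.Q.map φ.f := by
      rw [hφ, MorphismProperty.RightFraction.map_s_comp_map]
    have hiso : IsIso (P.isoModSerre.Q.map φ.s) :=
      Localization.inverts P.isoModSerre.Q P.isoModSerre _ φ.hs
    by_cases h : IsZero (Abelian.image φ.f)
    · left
      have hf : φ.f = 0 := by
        rw [← Abelian.image.fac φ.f, h.eq_of_src (Abelian.image.ι φ.f) 0, comp_zero]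
      rw [hf, Functor.map_zero] at hs
      have : S.arrow = 0 := by
        rw [← cancel_epi (P.isoModSerre.Q.objObjPreimageIso
          (S : P.isoModSerre.Localization)).hom, ← cancel_epi (P.isoModSerre.Q.map φ.s), hs]
        simp
      rw [← Subobject.mk_arrow S, Subobject.mk_eq_bot_iff_zero, this]
    · right
      have h1 : P.epiModSerre φ.f := by
        have h2 : P.epiModSerre (Abelian.image.ι φ.f) := hM _ h
        rw [← Abelian.image.fac φ.f]
        exact P.epiModSerre.comp_mem _ _ (P.epiModSerre_of_epi _) h2
      have h3 := (SerreClassLocalization.epi_map_iff P.isoModSerre.Q P φ.f).2 h1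
      rw [← hs] at h3
      have : Epi S.arrow := by
        rw [← Category.assoc] at h3
        exact epi_of_epi (P.isoModSerre.Q.map φ.s ≫
          (P.isoModSerre.Q.objObjPreimageIso (S : P.isoModSerre.Localization)).hom) S.arrow
      have : IsIso S.arrow := isIso_of_mono_of_epi _
      exact Subobject.eq_top_of_isIso_arrow S
  have : Finite (Subobject (P.isoModSerre.Q.obj M)) :=
    Set.finite_univ_iff.1 (Set.Finite.subset (Set.toFinite {⊥, ⊤}) fun S _ => by simpa using key S)
  exact (hasFiniteLength_iff (P.isoModSerre.Q.obj M)).2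
    ⟨Finite.to_wellFoundedGT, Finite.to_wellFoundedLT⟩

variable {P}

/-- As `g` is mono, `cokernel f` embeds into `cokernel (f ≫ g)`. -/
theorem prop_cokernel_of_comp {X Y Z : C} (f : X ⟶ Y) (g : Y ⟶ Z) [Mono g]
    (h : P (cokernel (f ≫ g))) : P (cokernel f) :=
  P.prop_X₂_of_exact ((kernelCokernelCompSequence_exact f g).exact 2)
    (P.monoModSerre_of_mono g) h

theorem IsCritical.of_mono {L T : C} (hL : IsCritical P L) (f : T ⟶ L) [Mono f]
    (hT : ¬ IsZero T) : IsCritical P T where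
  not_isZero := hT
  not_prop g _ h := hL.not_prop (g ≫ f) h
  prop_cokernel g _ h := prop_cokernel_of_comp g f (hL.prop_cokernel (g ≫ f) h)

theorem IsCritical.monoform {L : C} (hL : IsCritical P L) : Monoform L where
  not_isZero := hL.not_isZero
  not_iso L' M N h hL' hN := ⟨fun e => by
    refine hL.not_prop N.arrow ((subobject_ne_bot_iff _).1 hN) (P.prop_of_iso e ?_)
    refine prop_cokernel_of_comp _ M.arrow ?_
    exact hL.prop_cokernel _ ((subobject_ne_bot_iff _).1 hL')⟩

end Quotient

/-! ### Nonzero subobjects of a representative are directed -/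

section Representatives

variable {C : Type u} [Category.{v} C] [Abelian C]

theorem ASpec.monoform_rep (α : ASpec C) : Monoform α.rep := (Quotient.out α).2

theorem top_ne_bot_of_not_isZero {H : C} (h : ¬ IsZero H) : (⊤ : Subobject H) ≠ ⊥ := by
  rw [subobject_ne_bot_iff]
  exact fun h' => h (h'.of_iso (asIso (⊤ : Subobject H).arrow).symm)

instance (α : ASpec C) : Nonempty (NonzeroSubobject α.rep) :=
  ⟨⟨⊤, top_ne_bot_of_not_isZero α.monoform_rep.not_isZero⟩⟩

instance (α : ASpec C) : Nonempty (NonzeroSubobject α.rep)ᵒᵈ :=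
  inferInstanceAs (Nonempty (NonzeroSubobject α.rep))

/-- The intersection of two nonzero subobjects of the representative of an atom. -/
noncomputable def ASpec.inf (α : ASpec C) (L M : NonzeroSubobject α.rep) :
    NonzeroSubobject α.rep :=
  ⟨L.1 ⊓ M.1, α.monoform_rep.inf_ne_bot L.2 M.2⟩

theorem ASpec.inf_le_left (α : ASpec C) (L M : NonzeroSubobject α.rep) : α.inf L M ≤ L :=
  Subtype.coe_le_coe.1 (_root_.inf_le_left (a := L.1) (b := M.1))

theorem ASpec.inf_le_right (α : ASpec C) (L M : NonzeroSubobject α.rep) : α.inf L M ≤ M :=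
  Subtype.coe_le_coe.1 (_root_.inf_le_right (a := L.1) (b := M.1))

instance (α : ASpec C) : IsDirectedOrder (NonzeroSubobject α.rep)ᵒᵈ where
  directed a b := ⟨OrderDual.toDual (α.inf (OrderDual.ofDual a) (OrderDual.ofDual b)),
    α.inf_le_left _ _, α.inf_le_right _ _⟩

end Representatives

/-! ### Long exact sequences for extension groups of atoms -/

section Ext

variable {C : Type u} [Category.{v} C] [Abelian C] [HasExt.{w} C] {i : ℕ} {α : ASpec C}

instance {H : C} (N : C) : DirectedSystem
    (fun H' : (NonzeroSubobject H)ᵒᵈ => Ext ((OrderDual.ofDual H').1 : C) N i)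
    fun H₁ H₂ h => extRestrict i N H₁ H₂ h where
  map_self H' x := by simp [extRestrict]
  map_map H₁ H₂ H₃ h h' x := by
    have e := Subobject.ofLE_comp_ofLE (OrderDual.ofDual H₁).1 (OrderDual.ofDual H₂).1
      (OrderDual.ofDual H₃).1 h' h
    simp [extRestrict, ← e]

namespace AtomExt

open scoped Classical in
/-- The canonical map from `Ext^i(H', N)` to `Ext^i(α, N)`. -/
noncomputable def of (i : ℕ) (α : ASpec C) (N : C) (H' : NonzeroSubobject α.rep) :
    Ext (H'.1 : C) N i →+ AtomExt i α N :=
  AddCommGroup.DirectLimit.of (ι := (NonzeroSubobject α.rep)ᵒᵈ) _ (extRestrict i N)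
    (OrderDual.toDual H')

theorem of_precomp {N : C} {H₁ H₂ : NonzeroSubobject α.rep} (h : H₂ ≤ H₁)
    (x : Ext (H₁.1 : C) N i) :
    of i α N H₂ ((Ext.mk₀ (Subobject.ofLE H₂.1 H₁.1 h)).comp x (zero_add i)) = of i α N H₁ x := by
  classical
  exact AddCommGroup.DirectLimit.of_f (ι := (NonzeroSubobject α.rep)ᵒᵈ)
    (i := OrderDual.toDual H₁) (j := OrderDual.toDual H₂) (f := extRestrict i N) h x

theorem exists_of {N : C} (z : AtomExt i α N) : ∃ H' x, of i α N H' x = z := by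
  classical
  refine AddCommGroup.DirectLimit.induction_on z fun H' x => ?_
  exact ⟨OrderDual.ofDual H', x, rfl⟩

theorem exists_precomp_eq_zero {N : C} {H₁ : NonzeroSubobject α.rep} {x : Ext (H₁.1 : C) N i}
    (hx : of i α N H₁ x = 0) : ∃ (H₂ : NonzeroSubobject α.rep) (h : H₂ ≤ H₁),
      (Ext.mk₀ (Subobject.ofLE H₂.1 H₁.1 h)).comp x (zero_add i) = 0 := by
  classical
  obtain ⟨H₂, h, e⟩ := AddCommGroup.DirectLimit.of.zero_exact (ι := (NonzeroSubobject α.rep)ᵒᵈ)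
    (f := extRestrict i N) _ _ hx
  exact ⟨OrderDual.ofDual H₂, h, e⟩

theorem map_of {N N' : C} (f : N ⟶ N') (H' : NonzeroSubobject α.rep) (x : Ext (H'.1 : C) N i) :
    map i α f (of i α N H' x) = of i α N' H' (x.comp (Ext.mk₀ f) (add_zero i)) := by
  classical
  exact AddCommGroup.DirectLimit.map_apply_of _ _ _

theorem map_comp_apply {N N' N'' : C} (f : N ⟶ N') (g : N' ⟶ N'') (z : AtomExt i α N) :
    map i α (f ≫ g) z = map i α g (map i α f z) := by
  obtain ⟨H', x, rfl⟩ := exists_of z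
  simp [map_of]

theorem subsingleton_of_isZero {N : C} (hN : IsZero N) : Subsingleton (AtomExt i α N) := by
  refine subsingleton_of_forall_eq 0 fun z => ?_
  obtain ⟨H', x, rfl⟩ := exists_of z
  have : x = x.comp (Ext.mk₀ (𝟙 N)) (add_zero i) := by simp
  rw [this, hN.eq_of_src (𝟙 N) 0]
  simp

theorem map_surjective {X Y Z : C} {f : X ⟶ Y} {g : Y ⟶ Z} {zero : f ≫ g = 0}
    (hS : (ShortComplex.mk f g zero).ShortExact) (h₃ : Subsingleton (AtomExt i α Z)) :
    Function.Surjective (map i α f) := by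
  intro z
  obtain ⟨H₁, x, rfl⟩ := exists_of z
  obtain ⟨H₂, h, e⟩ := exists_precomp_eq_zero (α := α)
    (x := x.comp (Ext.mk₀ g) (add_zero i)) (h₃.elim _ _)
  obtain ⟨y, hy⟩ := Ext.covariant_sequence_exact₂ _ hS
    ((Ext.mk₀ (Subobject.ofLE H₂.1 H₁.1 h)).comp x (zero_add i)) (by simpa using e)
  exact ⟨of i α _ H₂ y, by rw [map_of, hy, of_precomp]⟩

theorem map_injective {X Y Z : C} {f : X ⟶ Y} {g : Y ⟶ Z} {zero : f ≫ g = 0}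
    (hS : (ShortComplex.mk f g zero).ShortExact) (h₃ : Subsingleton (AtomExt i α Z)) :
    Function.Injective (map (i + 1) α f) := by
  rw [injective_iff_map_eq_zero]
  intro z hz
  obtain ⟨H₁, x, rfl⟩ := exists_of z
  rw [map_of] at hz
  obtain ⟨H₂, h, e⟩ := exists_precomp_eq_zero hz
  obtain ⟨y, hy⟩ := Ext.covariant_sequence_exact₁ _ hS
    ((Ext.mk₀ (Subobject.ofLE H₂.1 H₁.1 h)).comp x (zero_add _)) (by simpa using e) rfl
  -- The preimage `y` under the connecting map need not vanish on `H₂`, only on a smaller `H₃`.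
  obtain ⟨H₃, h', e'⟩ := exists_precomp_eq_zero (α := α) (x := y) (h₃.elim _ _)
  rw [← of_precomp h, ← of_precomp h', ← hy, 
    ← Ext.comp_assoc _ _ _ (zero_add i) rfl (by omega), e']
  simp

theorem subsingleton_of_shortExact {X Y Z : C} {f : X ⟶ Y} {g : Y ⟶ Z} {zero : f ≫ g = 0}
    (hS : (ShortComplex.mk f g zero).ShortExact) (h₁ : Subsingleton (AtomExt i α X))
    (h₃ : Subsingleton (AtomExt i α Z)) : Subsingleton (AtomExt i α Y) :=
  (map_surjective hS h₃).subsingleton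

theorem map_bijective {X Y : C} (f : X ⟶ Y) [Mono f]
    (h : Subsingleton (AtomExt i α (cokernel f)))
    (h' : Subsingleton (AtomExt (i + 1) α (cokernel f))) :
    Function.Bijective (map (i + 1) α f) := by
  have hS : (ShortComplex.mk f (cokernel.π f) (cokernel.condition f)).ShortExact :=
    { exact := ShortComplex.exact_cokernel f }
  exact ⟨map_injective hS h, map_surjective hS h'⟩

theorem subsingleton_of_iso {X Y : C} (e : X ≅ Y) (h : Subsingleton (AtomExt i α X)) :
    Subsingleton (AtomExt i α Y) := by
  refine Function.Surjective.subsingleton (f := map i α e.hom) fun z =>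
    ⟨map i α e.inv z, ?_⟩
  obtain ⟨H', x, rfl⟩ := exists_of z
  simp [map_of]

end AtomExt

/-- Below `K` the system is constant, so each class on `K` extends to a compatible family and the
inverse limit surjects onto the value at `K`. -/
theorem subsingleton_of_notMem_constSet {β : ASpec C} {K : NonzeroSubobject β.rep}
    (hK : ∀ (H₂ H₁ : NonzeroSubobject β.rep) (h : H₂ ≤ H₁), H₁ ≤ K →
      Function.Bijective (AtomExt.map i α (Subobject.ofLE H₂.1 H₁.1 h)))
    (hβ : β ∉ ConstSet i α) : Subsingleton (AtomExt i α (K.1 : C)) := by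
  have hsub : Subsingleton (atomExtAtom i α β) := by
    rw [← not_nontrivial_iff_subsingleton]
    exact fun h => hβ ⟨⟨K, hK⟩, h⟩
  refine subsingleton_of_forall_eq 0 fun z => ?_
  -- The component at an arbitrary `H` is found by lifting `z` to `K ⊓ H` and pushing the lift to
  -- `H`.
  have hb (H : NonzeroSubobject β.rep) := hK _ _ (β.inf_le_left K H) le_rfl
  choose y hy using fun H => (hb H).2 z
  let x : ∀ H : NonzeroSubobject β.rep, AtomExt i α (H.1 : C) := fun H =>
    AtomExt.map i α (Subobject.ofLE _ _ (β.inf_le_right K H)) (y H)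
  have hx : x ∈ atomExtAtom i α β := by
    intro H₂ H₁ h
    have hle : β.inf K H₂ ≤ β.inf K H₁ :=
      Subtype.coe_le_coe.1 (inf_le_inf_left K.1 (Subtype.coe_le_coe.2 h))
    have e : AtomExt.map i α (Subobject.ofLE _ _ hle) (y H₂) = y H₁ := by
      refine (hb H₁).1 ?_
      rw [← AtomExt.map_comp_apply, Subobject.ofLE_comp_ofLE, hy, hy]
    change AtomExt.map i α _ (AtomExt.map i α _ (y H₂)) = AtomExt.map i α _ (y H₁)
    rw [← e, ← AtomExt.map_comp_apply, ← AtomExt.map_comp_apply, Subobject.ofLE_comp_ofLE,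
      Subobject.ofLE_comp_ofLE]
  have h0 : x K = 0 := congrFun (congrArg Subtype.val (hsub.elim ⟨x, hx⟩ 0)) K
  rw [← hy K, ← h0]

end Ext

/-! ### The induction step: vanishing on noetherian objects -/

section Vanishing

variable {C : Type u} [Category.{v} C] [Abelian C] [HasExt.{w} C] {α : ASpec C}
  {P : ObjectProperty C} {n : ℕ}

/-- The long exact sequence needs the cokernel to have no extensions in degrees `i - 1` and `i`.
This is why the bound grows by one with each step of the filtration. -/
theorem map_bijective_of_prop_cokernel
    (hP : ∀ N, P N → ∀ i, n ≤ i → Subsingleton (AtomExt i α N)) {X Y : C} (f : X ⟶ Y) [Mono f]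
    (hf : P (cokernel f)) {i : ℕ} (hi : n < i) : Function.Bijective (AtomExt.map i α f) := by
  obtain ⟨i, rfl⟩ : ∃ j, i = j + 1 := ⟨i - 1, by omega⟩
  exact AtomExt.map_bijective f (hP _ hf _ (by omega)) (hP _ hf _ (by omega))

variable [P.IsSerreClass]

theorem subsingleton_of_isCritical
    (hP : ∀ N, P N → ∀ i, n ≤ i → Subsingleton (AtomExt i α N))
    (hc : ∀ i, n < i → ConstSet i α = ∅) {L : C} (hL : IsCritical P L) {i : ℕ} (hi : n < i) :
    Subsingleton (AtomExt i α L) := by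
  let β : ASpec C := Quotient.mk _ ⟨L, hL.monoform⟩
  have hβ : AtomEquivalent β.rep L := Quotient.exact (Quotient.out_eq β)
  -- The fixed representative of `β` is only atom-equivalent to `L`, so vanishing is shown on a
  -- common nonzero subobject `X` and then carried to `L`.
  obtain ⟨X, f, g, hX, _, _⟩ := atomEquivalent_iff.1 hβ
  have hXc : IsCritical P X := hL.of_mono g hX
  let K : NonzeroSubobject β.rep := ⟨Subobject.mk f, (subobject_ne_bot_iff _).2 fun h =>
    hX (h.of_iso (Subobject.underlyingIso f).symm)⟩
  have hKX : (K.1 : C) ≅ X := Subobject.underlyingIso f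
  have hK : Subsingleton (AtomExt i α (K.1 : C)) := by
    refine subsingleton_of_notMem_constSet (β := β) (fun H₂ H₁ h hH₁ => ?_)
      (by simp [hc i hi])
    have hH₁c : IsCritical P (H₁.1 : C) :=
      hXc.of_mono (Subobject.ofLE H₁.1 K.1 hH₁ ≫ hKX.hom) ((subobject_ne_bot_iff _).1 H₁.2)
    exact map_bijective_of_prop_cokernel hP _
      (hH₁c.prop_cokernel _ ((subobject_ne_bot_iff _).1 H₂.2)) hi
  have := AtomExt.subsingleton_of_iso hKX hK
  exact (map_bijective_of_prop_cokernel hP g (hL.prop_cokernel g hX) hi).2.subsingleton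

theorem subsingleton_of_finiteLengthMod
    (hP : ∀ N, P N → ∀ i, n ≤ i → Subsingleton (AtomExt i α N))
    (hc : ∀ i, n < i → ConstSet i α = ∅) {N : C} [IsNoetherianObject N]
    (hN : finiteLengthMod P N) {i : ℕ} (hi : n < i) : Subsingleton (AtomExt i α N) := by
  obtain ⟨M, hM, hmax⟩ := WellFounded.has_min (wellFounded_gt (α := Subobject N))
    {M | Subsingleton (AtomExt i α (M : C))}
    ⟨⊥, AtomExt.subsingleton_of_isZero ((isZero_zero C).of_iso Subobject.botCoeIsoZero)⟩
  by_cases h0 : IsZero (cokernel M.arrow)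
  · have : Epi M.arrow := Preadditive.epi_of_isZero_cokernel _ h0
    have : IsIso M.arrow := isIso_of_mono_of_epi _
    exact AtomExt.subsingleton_of_iso (asIso M.arrow) hM
  exfalso
  obtain ⟨L, f, _, hL, h⟩ := exists_prop_or_isCritical P
    ((finiteLengthMod P).prop_of_epi (cokernel.π M.arrow) hN) h0
  have hLs : Subsingleton (AtomExt i α L) := by
    rcases h with h | h
    · exact hP L h i hi.le
    · exact subsingleton_of_isCritical hP hc h hi
  -- The preimage of `L` in `N` is an extension of `L` by `M`, which contradicts the maximality of
  -- `M`.
  let E := pullback f (cokernel.π M.arrow)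
  let j : (M : C) ⟶ E := pullback.lift 0 M.arrow (by simp)
  have hj : j ≫ pullback.snd f (cokernel.π M.arrow) = M.arrow := pullback.lift_snd _ _ _
  have hjf : j ≫ pullback.fst f (cokernel.π M.arrow) = 0 := pullback.lift_fst _ _ _
  have : Mono j := mono_of_mono_fac hj
  have hS : (ShortComplex.mk j (pullback.fst f (cokernel.π M.arrow)) hjf).ShortExact := by
    refine { exact := ShortComplex.exact_of_f_is_kernel _ (KernelFork.IsLimit.ofι' _ _ ?_) }
    intro A k hk
    have hk' : (k ≫ pullback.snd f (cokernel.π M.arrow)) ≫ cokernel.π M.arrow = 0 := by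
      rw [Category.assoc, ← pullback.condition, ← Category.assoc, hk, zero_comp]
    refine ⟨Abelian.monoLift M.arrow _ hk', ?_⟩
    rw [← cancel_mono (pullback.snd f (cokernel.π M.arrow)), Category.assoc, hj,
      Abelian.monoLift_comp]
  have hE := AtomExt.subsingleton_of_shortExact hS hM hLs
  let M' : Subobject N := Subobject.mk (pullback.snd f (cokernel.π M.arrow))
  have hM' : Subsingleton (AtomExt i α (M' : C)) :=
    AtomExt.subsingleton_of_iso (Subobject.underlyingIso _).symm hE
  refine hmax M' hM' (lt_of_le_not_ge (Subobject.le_mk_of_comm j hj) fun h => hL ?_)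
  have hz : pullback.fst f (cokernel.π M.arrow) ≫ f = 0 := by
    rw [pullback.condition, ← Subobject.ofMkLE_arrow h, Category.assoc, cokernel.condition,
      comp_zero]
  have : f = 0 := by rwa [← cancel_epi (pullback.fst f (cokernel.π M.arrow)), comp_zero]
  exact IsZero.of_mono_eq_zero f this

end Vanishing

/-! ### Reduction to noetherian subobjects -/

section LocallyNoetherian

variable {C : Type u} [Category.{v} C] [Abelian C]

theorem isNoetherianObject_of_epi {X Y : C} (p : X ⟶ Y) [Epi p] [IsNoetherianObject X] :
    IsNoetherianObject Y :=
  (isNoetherianObject.is_iff Y).2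
    (isNoetherianObject.prop_of_epi p ((isNoetherianObject.is_iff X).1 inferInstance))

/-- In a category with noetherian generators, an epimorphism onto a noetherian object restricts to
an epimorphism on some noetherian subobject of its source. -/
theorem exists_isNoetherianObject_epi (hG : HasNoetherianGenerators C) {E X : C} (p : E ⟶ X)
    [Epi p] [IsNoetherianObject X] :
    ∃ (E' : C) (e : E' ⟶ E), IsNoetherianObject E' ∧ Mono e ∧ Epi (e ≫ p) := by
  obtain ⟨ι, U, hU, hsep⟩ := hG
  obtain ⟨S, ⟨E', e, hE', rfl⟩, hmax⟩ := WellFounded.has_min (wellFounded_gt (α := Subobject X))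
    {S | ∃ (E' : C) (e : E' ⟶ E), IsNoetherianObject E' ∧ imageSubobject (e ≫ p) = S}
    ⟨_, _, 0, isNoetherianObject_of_isZero (isZero_zero C), rfl⟩
  -- Adjoining a map from a generator to `e` cannot enlarge the maximal image, so every map from a
  -- generator to `E` lands in it after `p`.
  have hq : cokernel.π (imageSubobject (e ≫ p)).arrow = 0 := by
    rw [← cancel_epi p, comp_zero]
    refine hsep _ _ ?_
    rintro _ ⟨i⟩ h
    rw [comp_zero, ← Category.assoc, ← factors_iff_comp_eq_zero]
    have hE'' : IsNoetherianObject (E' ⊞ U i) := (isNoetherianObject.is_iff _).2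
      (isNoetherianObject.prop_biprod ((isNoetherianObject.is_iff _).1 hE')
        ((isNoetherianObject.is_iff _).1 (hU i)))
    have hle : imageSubobject (e ≫ p) ≤ imageSubobject (biprod.desc e h ≫ p) :=
      imageSubobject_le _ (biprod.inl ≫ factorThruImageSubobject (biprod.desc e h ≫ p)) (by simp)
    have hge : imageSubobject (biprod.desc e h ≫ p) ≤ imageSubobject (e ≫ p) := by
      by_contra h'
      exact hmax _ ⟨_, biprod.desc e h, hE'', rfl⟩ (lt_of_le_not_ge hle h')
    have hf : (imageSubobject (biprod.desc e h ≫ p)).Factors (h ≫ p) := by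
      simpa using imageSubobject_factors_comp_self (biprod.desc e h ≫ p) biprod.inr
    exact Subobject.factors_of_le _ hge hf
  have : Epi (imageSubobject (e ≫ p)).arrow := Preadditive.epi_of_cokernel_zero hq
  have hep : Epi (e ≫ p) := by
    rw [← imageSubobject_arrow_comp (e ≫ p)]
    infer_instance
  refine ⟨Abelian.image e, Abelian.image.ι e,
    isNoetherianObject_of_epi (Abelian.factorThruImage e), inferInstance, ?_⟩
  refine epi_of_epi_fac (f := Abelian.factorThruImage e) (h := e ≫ p) ?_
  rw [← Category.assoc, Abelian.image.fac]

/-- Dimension shifting: embed `N` in an injective. By induction the shifted class comes from a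
noetherian subobject `Q` of the quotient; a noetherian subobject of the injective maps onto `Q`, and
its kernel over `Q` is the desired subobject of `N`. -/
theorem exists_isNoetherianObject_ext [HasExt.{w} C] [EnoughInjectives C]
    (hG : HasNoetherianGenerators C) {H : C} [IsNoetherianObject H] {i : ℕ} :
    ∀ {N : C} (x : Ext H N i), ∃ (N' : C) (f : N' ⟶ N) (y : Ext H N' i),
      IsNoetherianObject N' ∧ Mono f ∧ y.comp (Ext.mk₀ f) (add_zero i) = x := by
  induction i with
  | zero =>
    intro N x
    obtain ⟨g, rfl⟩ := Ext.addEquiv₀.symm.surjective x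
    exact ⟨Abelian.image g, Abelian.image.ι g, Ext.mk₀ (Abelian.factorThruImage g),
      isNoetherianObject_of_epi (Abelian.factorThruImage g), inferInstance, by simp⟩
  | succ i ih =>
    intro N x
    have hS : (ShortComplex.mk (Injective.ι N) (cokernel.π (Injective.ι N))
      (cokernel.condition _)).ShortExact := { exact := ShortComplex.exact_cokernel _ }
    obtain ⟨z, rfl⟩ := Ext.covariant_sequence_exact₁ H hS x (Ext.eq_zero_of_injective _) rfl
    obtain ⟨Q, q, y, _, _, rfl⟩ := ih z
    obtain ⟨I, e, _, _, _⟩ := exists_isNoetherianObject_epi hG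
      (pullback.snd (cokernel.π (Injective.ι N)) q)
    let p : I ⟶ Q := e ≫ pullback.snd (cokernel.π (Injective.ι N)) q
    let a : I ⟶ Injective.under N := e ≫ pullback.fst (cokernel.π (Injective.ι N)) q
    have hap : a ≫ cokernel.π (Injective.ι N) = p ≫ q := by
      simp [a, p, pullback.condition]
    have hS' : (ShortComplex.mk (kernel.ι p) p (kernel.condition p)).ShortExact :=
      { exact := ShortComplex.exact_kernel p
        epi_g := inferInstanceAs (Epi (e ≫ _)) }
    have hk : (kernel.ι p ≫ a) ≫ cokernel.π (Injective.ι N) = 0 := by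
      rw [Category.assoc, hap, kernel.condition_assoc, zero_comp]
    let f : kernel p ⟶ N := Abelian.monoLift (Injective.ι N) _ hk
    have hf : f ≫ Injective.ι N = kernel.ι p ≫ a := Abelian.monoLift_comp _ _ _
    have : Mono a := inferInstanceAs (Mono (e ≫ _))
    have : Mono f := mono_of_mono_fac hf
    let φ : ShortComplex.mk (kernel.ι p) p (kernel.condition p) ⟶
      ShortComplex.mk (Injective.ι N) (cokernel.π (Injective.ι N)) (cokernel.condition _) :=
      { τ₁ := f, τ₂ := a, τ₃ := q }
    refine ⟨kernel p, f, y.comp hS'.extClass rfl, isNoetherianObject_of_mono (kernel.ι p),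
      inferInstance, ?_⟩
    have hnat := ShortComplex.ShortExact.extClass_naturality hS' hS φ
    rw [Ext.comp_assoc_of_third_deg_zero, hnat, Ext.comp_assoc_of_second_deg_zero]

/-- The objects all of whose noetherian subobjects are in `Q`. -/
def noetherianSubobjectsIn (Q : ObjectProperty C) : ObjectProperty C :=
  fun N => ∀ ⦃X : C⦄ (f : X ⟶ N) [Mono f] [IsNoetherianObject X], Q X

theorem noetherianSubobjectsIn_isSerreClass (hG : HasNoetherianGenerators C)
    (Q : ObjectProperty C) [Q.IsSerreClass] : (noetherianSubobjectsIn Q).IsSerreClass where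
  exists_zero := ⟨_, isZero_zero C, fun X f _ _ =>
    Q.prop_of_isZero ((isZero_zero C).of_mono f)⟩
  prop_of_mono g _ h X f _ _ := h (f ≫ g)
  prop_of_epi g _ h X f _ _ := by
    obtain ⟨E, e, _, _, _⟩ := exists_isNoetherianObject_epi hG (pullback.snd g f)
    exact Q.prop_of_epi (e ≫ pullback.snd g f) (h (e ≫ pullback.fst g f))
  prop_X₂_of_shortExact {S} hS h₁ h₃ X f _ _ := by
    have := hS.mono_f
    have hk : (kernel.ι (f ≫ S.g) ≫ f) ≫ S.g = 0 := by simp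
    let k := hS.exact.lift _ hk
    have hke : k ≫ S.f = kernel.ι (f ≫ S.g) ≫ f := hS.exact.lift_f _ hk
    have : Mono k := mono_of_mono_fac hke
    have := isNoetherianObject_of_mono (kernel.ι (f ≫ S.g))
    have := isNoetherianObject_of_epi (Abelian.factorThruImage (f ≫ S.g))
    have hker : Q (kernel (f ≫ S.g)) := h₁ k
    have him : Q (Abelian.image (f ≫ S.g)) := h₃ (Abelian.image.ι _)
    refine Q.prop_X₂_of_exact (ShortComplex.exact_kernel (Abelian.factorThruImage (f ≫ S.g)))
      ?_ him
    exact Q.prop_of_mono (kernel.lift (f ≫ S.g) (kernel.ι _) (by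
      have := kernel.condition_assoc (Abelian.factorThruImage (f ≫ S.g))
        (Abelian.image.ι (f ≫ S.g))
      rwa [Abelian.image.fac, zero_comp] at this)) hker

end LocallyNoetherian

/-! ### Noetherian objects in localizing closures -/

section Grothendieck

variable {C : Type u} [Category.{v} C] [Abelian C]

theorem prop_finite_coproduct (P : ObjectProperty C) [P.IsSerreClass] {ι : Type v} (F : ι → C)
    (hF : ∀ i, P (F i)) (s : Finset ι) : P (∐ fun x : s => F x) := by
  classical
  induction s using Finset.induction_on with
  | empty =>
    refine P.prop_of_isZero ((IsZero.iff_id_eq_zero _).2 ?_)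
    ext ⟨x, hx⟩
    simp at hx
  | insert a s _ ih =>
    let e : (∐ fun x : s => F x) ⊞ F a ⟶ ∐ fun x : (insert a s : Finset ι) => F x :=
      biprod.desc (Sigma.desc fun x => Sigma.ι (fun x : (insert a s : Finset ι) => F x)
        ⟨x.1, Finset.mem_insert_of_mem x.2⟩)
        (Sigma.ι (fun x : (insert a s : Finset ι) => F x) ⟨a, Finset.mem_insert_self a s⟩)
    have : Epi e := by
      refine Preadditive.epi_of_cancel_zero _ fun {Z} g hg => ?_
      ext ⟨x, hx⟩
      rcases Finset.mem_insert.1 hx with rfl | hx'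
      · simpa [e] using biprod.inr ≫= hg
      · simpa [e] using Sigma.ι (fun x : s => F x) ⟨x, hx'⟩ ≫= (biprod.inl ≫= hg)
    exact P.prop_of_epi e (P.prop_biprod ih (hF a))

variable [IsGrothendieckAbelian.{v} C]

open IsGrothendieckAbelian.IsPresentable in
-- Filtered colimits are exact, so the pullbacks of the `Y.obj j` to `X` jointly cover `X`. As `X`
-- is noetherian, their images stabilize and a single one covers it.
theorem exists_epi_of_mono_colimit {J : Type v} [SmallCategory J] [IsFiltered J] {Y : J ⥤ C}
    {c : Cocone Y} (hc : IsColimit c) {X : C} [IsNoetherianObject X] (z : X ⟶ c.pt) [hz : Mono z] :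
    ∃ (j : J) (A : C) (a : A ⟶ Y.obj j) (p : A ⟶ X), Mono a ∧ Epi p := by
  let D := pullback c.ι ((Functor.const J).map z)
  let s : ∀ j, D.obj j ⟶ X := fun j => (pullback.snd c.ι ((Functor.const J).map z)).app j
  have hs : ∀ {j j' : J} (f : j ⟶ j'), D.map f ≫ s j' = s j := by
    intro j j' f
    have := (pullback.snd c.ι ((Functor.const J).map z)).naturality f
    exact this.trans (Category.comp_id _)
  have : Nonempty J := IsFiltered.nonempty
  obtain ⟨_, ⟨j, rfl⟩, hmax⟩ := WellFounded.has_min (wellFounded_gt (α := Subobject X))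
    (Set.range fun j => imageSubobject (s j)) (Set.range_nonempty _)
  have hle : ∀ {j j' : J} (_ : j ⟶ j'), imageSubobject (s j) ≤ imageSubobject (s j') := by
    intro j j' f
    exact imageSubobject_le _ (D.map f ≫ factorThruImageSubobject (s j')) (by simp [hs])
  have hj : ∀ j', imageSubobject (s j') ≤ imageSubobject (s j) := by
    intro j'
    refine (hle (IsFiltered.rightToMax j j')).trans ?_
    by_contra h
    exact hmax _ ⟨_, rfl⟩ (lt_of_le_not_ge (hle (IsFiltered.leftToMax j j')) h)
  have hq : cokernel.π (imageSubobject (s j)).arrow = 0 := by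
    have := surjectivity.epi_f hc z
    rw [← cancel_epi (surjectivity.f z), comp_zero]
    refine colimit.hom_ext fun j' => ?_
    rw [comp_zero, ← Category.assoc, surjectivity.hf, ← factors_iff_comp_eq_zero]
    refine Subobject.factors_of_le _ (hj j') ?_
    simpa using imageSubobject_factors_comp_self (s j') (𝟙 _)
  have : Epi (imageSubobject (s j)).arrow := Preadditive.epi_of_cokernel_zero hq
  have hep : Epi (s j) := by
    rw [← imageSubobject_arrow_comp (s j)]
    infer_instance
  have : Mono ((Functor.const J).map z) := NatTrans.mono_of_mono_app _
  exact ⟨j, D.obj j, (pullback.fst c.ι ((Functor.const J).map z)).app j, s j, inferInstance, hep⟩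

open CoproductsFromFiniteFiltered in
theorem noetherianSubobjectsIn_isLocalizing (hG : HasNoetherianGenerators C)
    (Q : ObjectProperty C) [Q.IsSerreClass] : IsLocalizing (noetherianSubobjectsIn Q) where
  isSerreClass := noetherianSubobjectsIn_isSerreClass hG Q
  isClosedUnderCoproducts ι := ⟨by
    rintro N ⟨h⟩ X f _ _
    have := noetherianSubobjectsIn_isSerreClass hG Q
    -- A coproduct is the filtered colimit of its finite subcoproducts.
    let e : N ≅ colimit (liftToFinsetObj h.diag) :=
      h.isColimit.coconePointUniqueUpToIso (liftToFinsetColimitCocone h.diag).isColimit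
    have hmono : Mono (f ≫ e.hom) := inferInstance
    obtain ⟨s, A, a, p, _, _⟩ := exists_epi_of_mono_colimit
      (colimit.isColimit (liftToFinsetObj h.diag)) (f ≫ e.hom) (hz := hmono)
    have hs := prop_finite_coproduct (noetherianSubobjectsIn Q) h.diag.obj h.prop_diag_obj s
    have hX : noetherianSubobjectsIn Q X :=
      ObjectProperty.prop_of_epi _ p (ObjectProperty.prop_of_mono _ a hs)
    exact hX (𝟙 X)⟩

/-- The objects whose noetherian subobjects are all in `Q` form a localizing subcategory containing
`Q`; the identity of `X` is then one of the monomorphisms tested. -/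
theorem prop_of_localizingClosure (hG : HasNoetherianGenerators C) (Q : ObjectProperty C)
    [Q.IsSerreClass] {X : C} [IsNoetherianObject X] (hX : localizingClosure Q X) : Q X :=
  hX _ (noetherianSubobjectsIn_isLocalizing hG Q) (fun _ hN _ f _ _ => Q.prop_of_mono f hN) (𝟙 X)

theorem exists_isNoetherianObject_nonzeroSubobject (hG : HasNoetherianGenerators C) {H : C}
    {L : Subobject H} (hL : L ≠ ⊥) :
    ∃ (M : Subobject H), M ≤ L ∧ M ≠ ⊥ ∧ IsNoetherianObject (M : C) := by
  rw [subobject_ne_bot_iff, IsZero.iff_id_eq_zero] at hL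
  obtain ⟨ι, U, hU, hsep⟩ := hG
  obtain ⟨i, g, hg⟩ : ∃ i, ∃ g : U i ⟶ (L : C), g ≠ 0 := by
    by_contra! h
    refine hL (hsep _ _ ?_)
    rintro _ ⟨i⟩ g
    simp [h i g]
  refine ⟨Subobject.mk (Abelian.image.ι g ≫ L.arrow),
    Subobject.mk_le_of_comm (Abelian.image.ι g) rfl, ?_, ?_⟩
  · rw [Ne, Subobject.mk_eq_bot_iff_zero]
    intro h
    have := zero_of_comp_mono _ h
    exact hg (by rw [← Abelian.image.fac g, this, comp_zero])
  · have := hU i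
    have := isNoetherianObject_of_epi (Abelian.factorThruImage g)
    exact isNoetherianObject_of_mono (Subobject.underlyingIso (Abelian.image.ι g ≫ L.arrow)).hom

theorem subsingleton_of_isNoetherianObject [HasExt.{w} C] (hG : HasNoetherianGenerators C)
    {α : ASpec C} {i : ℕ} {N : C}
    (hN : ∀ ⦃X : C⦄ (f : X ⟶ N) [Mono f] [IsNoetherianObject X], Subsingleton (AtomExt i α X)) :
    Subsingleton (AtomExt i α N) := by
  refine subsingleton_of_forall_eq 0 fun z => ?_
  obtain ⟨L, x, rfl⟩ := AtomExt.exists_of z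
  obtain ⟨M, hM, hM0, _⟩ := exists_isNoetherianObject_nonzeroSubobject hG L.2
  let M' : NonzeroSubobject α.rep := ⟨M, hM0⟩
  obtain ⟨N', f, y, _, _, hy⟩ := exists_isNoetherianObject_ext hG
    ((Ext.mk₀ (Subobject.ofLE M L.1 hM)).comp x (zero_add i))
  have hle : M' ≤ L := hM
  rw [← AtomExt.of_precomp hle, ← hy]
  change AtomExt.of i α N M' _ = 0
  rw [← AtomExt.map_of, (hN f).elim (AtomExt.of i α N' M' y) 0, map_zero]

end Grothendieck

/-! ### Filtrations that must terminate -/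

section Filtrations

variable {C : Type u} [Category.{v} C]

theorem monotone_of_le_add_one {F : Ordinal.{v} → ObjectProperty C}
    (hsucc : ∀ o, F o ≤ F (o + 1)) (hlim : ∀ o, Order.IsSuccLimit o → ∀ o' < o, F o' ≤ F o) :
    Monotone F := by
  intro a b
  induction b using Ordinal.limitRecOn with
  | zero => intro h; rw [nonpos_iff_eq_zero.1 h]
  | add_one b ih =>
    intro h
    rcases h.lt_or_eq with h | rfl
    · exact (ih (Order.lt_add_one_iff.1 h)).trans (hsucc b)
    · exact le_rfl
  | limit b hb ih =>
    intro h
    rcases h.lt_or_eq with h | rfl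
    · exact hlim b hb a h
    · exact le_rfl

/-- An increasing filtration that, unless it is exhausted, gains at each step a member of a fixed
small family of objects is exhausted at some ordinal. -/
theorem exists_forall_of_monotone {T : Type*} [Small.{v} T] (obj : T → C)
    {F : Ordinal.{v} → ObjectProperty C} (hF : Monotone F)
    (h : ∀ o, (∀ M, F o M) ∨ ∃ t, ¬ F o (obj t) ∧ F (o + 1) (obj t)) : ∃ o, ∀ M, F o M := by
  by_contra! hne
  have h' : ∀ o, ∃ t, ¬ F o (obj t) ∧ F (o + 1) (obj t) := fun o =>
    (h o).resolve_left fun hall => (hne o).elim fun M hM => hM (hall M)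
  choose t ht ht' using h'
  refine not_injective_of_ordinal t (Function.Injective.of_lt_imp_ne fun a b hab e => ?_)
  refine ht b ?_
  rw [← e]
  exact hF (Order.add_one_le_iff.2 hab) _ (ht' a)

variable [Abelian C]

/-- For `S` maximal with quotient outside `P`, every proper quotient of `cokernel S.arrow` is in
`P`. -/
theorem exists_finiteLengthMod_cokernel (P : ObjectProperty C) [P.IsSerreClass] {N : C}
    [IsNoetherianObject N] (hN : ¬ P N) :
    ∃ S : Subobject N, ¬ P (cokernel S.arrow) ∧ finiteLengthMod P (cokernel S.arrow) := by
  obtain ⟨S, hS, hmax⟩ := WellFounded.has_min (wellFounded_gt (α := Subobject N))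
    {S | ¬ P (cokernel S.arrow)} ⟨⊥, fun h => hN (by
      rw [Subobject.bot_arrow] at h
      exact P.prop_of_iso cokernelZeroIsoTarget h)⟩
  refine ⟨S, hS, finiteLengthMod_of_prop_cokernel P fun {T} f _ hT => ?_⟩
  let g : N ⟶ cokernel f := cokernel.π S.arrow ≫ cokernel.π f
  have hSg : S.arrow ≫ g = 0 := by simp [g]
  let S' : Subobject N := Subobject.mk (kernel.ι g)
  have hle : S ≤ S' := Subobject.le_mk_of_comm (kernel.lift g S.arrow hSg) (by simp)
  have hnle : ¬ S' ≤ S := by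
    intro h
    have h1 : pullback.snd f (cokernel.π S.arrow) ≫ g = 0 := by
      rw [← Category.assoc, ← pullback.condition, Category.assoc, cokernel.condition, comp_zero]
    have h2 : S.Factors (pullback.snd f (cokernel.π S.arrow)) := by
      refine Subobject.factors_of_le _ h ?_
      rw [← kernel.lift_ι g _ h1]
      exact (Subobject.mk_factors_iff _ _).2 ⟨_, rfl⟩
    rw [factors_iff_comp_eq_zero, ← pullback.condition] at h2
    have : f = 0 := by
      rwa [← cancel_epi (pullback.fst f (cokernel.π S.arrow)), comp_zero]
    exact hT (IsZero.of_mono_eq_zero f this)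
  have hP : P (cokernel S'.arrow) := by
    by_contra h
    exact hmax S' h (lt_of_le_not_ge hle hnle)
  have h0 : S'.arrow ≫ g = 0 := by
    rw [← Subobject.underlyingIso_hom_comp_eq_mk, Category.assoc, kernel.condition, comp_zero]
  have : Epi g := inferInstanceAs (Epi (_ ≫ _))
  have : Epi (cokernel.desc _ g h0) := epi_of_epi_fac (cokernel.π_desc _ g h0)
  exact P.prop_of_epi (cokernel.desc _ g h0) hP

theorem exists_isLeast (α : ASpec C) {G : WithBot Ordinal.{v} → ObjectProperty C}
    (hbot : G ⊥ = IsZero) (h : ∃ o : Ordinal.{v}, ∀ M, G o M) :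
    ∃ d : Ordinal.{v}, IsLeast {l | ∀ M, G l M} (d : WithBot Ordinal.{v}) ∧ ∀ M, G d M := by
  obtain ⟨o, ho⟩ := h
  obtain ⟨d, hd, hmin⟩ := WellFounded.has_min (wellFounded_lt (α := WithBot Ordinal.{v}))
    {l | ∀ M, G l M} ⟨o, ho⟩
  induction d using WithBot.recBotCoe with
  | bot =>
    have := hd α.rep
    rw [hbot] at this
    exact (α.monoform_rep.not_isZero this).elim
  | coe d => exact ⟨d, ⟨hd, fun l hl => not_lt.1 (hmin l hl)⟩, hd⟩

end Filtrations

/-! ### The induction along the filtration -/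

section Dimension

variable {C : Type u} [Category.{v} C] [Abelian C] [HasExt.{w} C] {α : ASpec C}

theorem constSet_eq_empty {c : ℕ} (hc : cprojDim α ≤ c) {i : ℕ} (hi : c < i) :
    ConstSet i α = ∅ := by
  by_contra h
  have : (i : ℕ∞) ≤ cprojDim α :=
    le_iSup₂_of_le i (Set.nonempty_iff_ne_empty.2 h) le_rfl
  exact absurd (this.trans hc) (by simpa using hi)

theorem projDim_le_of_subsingleton {n : ℕ}
    (h : ∀ (N : C) i, n < i → Subsingleton (AtomExt i α N)) : projDim α ≤ n := by
  refine iSup₂_le fun i hi => ?_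
  obtain ⟨N, hN⟩ := hi
  by_contra hlt
  have := h N i (by simpa using hlt)
  exact not_nontrivial _ hN

theorem projDim_le_cprojDim_add {S : ObjectProperty C → ObjectProperty C}
    {F : Ordinal.{v} → ObjectProperty C} (hzero : F 0 = S IsZero)
    (hsucc : ∀ o, F (o + 1) = S (F o)) (hF : ∀ o, (F o).IsSerreClass)
    (hS : ∀ (P : ObjectProperty C) [P.IsSerreClass] (n : ℕ),
      (∀ N, P N → ∀ i, n ≤ i → Subsingleton (AtomExt i α N)) →
      (∀ i, n < i → ConstSet i α = ∅) →
      ∀ N, S P N → ∀ i, n < i → Subsingleton (AtomExt i α N))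
    {d : Ordinal.{v}} (hd : ∀ M, F d M) :
    projDim α ≤ cprojDim α + ordinalToENat d := by
  rcases lt_or_ge d Ordinal.omega0 with h | h
  · obtain ⟨k, rfl⟩ := Ordinal.lt_omega0.1 h
    by_cases hc : cprojDim α = ⊤
    · simp [hc]
    obtain ⟨c, hc⟩ := ENat.ne_top_iff_exists.1 hc
    have key : ∀ (k : ℕ) (N : C), F k N → ∀ i, c + k < i → Subsingleton (AtomExt i α N) := by
      intro k
      induction k with
      | zero =>
        rw [Nat.cast_zero, hzero]
        -- Index `0` is already one step above the zero objects, on which everything vanishes, so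
        -- the induction starts from `n = c` with no loss.
        exact hS _ c (fun N hN i _ => AtomExt.subsingleton_of_isZero hN)
          fun i hi => constSet_eq_empty hc.ge hi
      | succ k ih =>
        have := hF k
        rw [Nat.cast_succ, hsucc]
        -- Vanishing in degrees `> c + k` is vanishing in degrees `≥ n` for `n = c + k + 1`.
        exact hS _ (c + k + 1) (fun N hN i hi => ih N hN i (by omega))
          fun i hi => constSet_eq_empty hc.ge (by omega)
    have hk : ordinalToENat.{v} (k : Ordinal.{v}) = k := by simp [ordinalToENat]
    rw [hk, ← hc, ← Nat.cast_add]
    exact projDim_le_of_subsingleton fun N => key k N (hd N)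
  · have : ordinalToENat d = ⊤ := by
      simpa [ordinalToENat] using h
    simp [this]

end Dimension

/-! ### Noetherian abelian categories -/

section Noetherian

variable {C : Type u} [Category.{v} C] [Abelian C]

theorem noethGabrielOrd_zero : noethGabrielOrd C 0 = finiteLengthMod IsZero :=
  Ordinal.limitRecOn_zero ..

theorem noethGabrielOrd_add_one (o : Ordinal.{v}) :
    noethGabrielOrd C (o + 1) = finiteLengthMod (noethGabrielOrd C o) :=
  Ordinal.limitRecOn_add_one ..

theorem noethGabrielOrd_limit_iff {o : Ordinal.{v}} (ho : Order.IsSuccLimit o) (M : C) :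
    noethGabrielOrd C o M ↔ ∃ o' < o, noethGabrielOrd C o' M := by
  rw [noethGabrielOrd, Ordinal.limitRecOn_limit _ _ _ _ ho]
  simp only [exists_prop]
  rfl

/-- The two claims need a joint induction: closure under extensions at a limit brings both ends into
one earlier member, and monotonicity at a successor uses the Serre property. -/
theorem noethGabrielOrd_isSerreClass_and_le (o : Ordinal.{v}) :
    (noethGabrielOrd C o).IsSerreClass ∧
      ∀ o' ≤ o, noethGabrielOrd C o' ≤ noethGabrielOrd C o := by
  induction o using Ordinal.limitRecOn with
  | zero =>
    refine ⟨by rw [noethGabrielOrd_zero]; infer_instance, fun o' h => ?_⟩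
    rw [nonpos_iff_eq_zero.1 h]
  | add_one o ih =>
    have := ih.1
    refine ⟨by rw [noethGabrielOrd_add_one]; infer_instance, fun o' h => ?_⟩
    rcases h.lt_or_eq with h | rfl
    · rw [noethGabrielOrd_add_one]
      exact (ih.2 _ (Order.lt_add_one_iff.1 h)).trans (le_finiteLengthMod _)
    · exact le_rfl
  | limit o ho ih =>
    constructor
    · exact
      { exists_zero := by
          have := (ih 0 ho.bot_lt).1
          exact ⟨_, isZero_zero C, (noethGabrielOrd_limit_iff ho _).2
            ⟨0, ho.bot_lt, ObjectProperty.prop_of_isZero _ (isZero_zero C)⟩⟩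
        prop_of_mono := fun f _ h => by
          obtain ⟨o', ho', h⟩ := (noethGabrielOrd_limit_iff ho _).1 h
          have := (ih o' ho').1
          exact (noethGabrielOrd_limit_iff ho _).2 ⟨o', ho', ObjectProperty.prop_of_mono _ f h⟩
        prop_of_epi := fun f _ h => by
          obtain ⟨o', ho', h⟩ := (noethGabrielOrd_limit_iff ho _).1 h
          have := (ih o' ho').1
          exact (noethGabrielOrd_limit_iff ho _).2 ⟨o', ho', ObjectProperty.prop_of_epi _ f h⟩
        prop_X₂_of_shortExact := fun hS h₁ h₃ => by
          obtain ⟨a, ha, h₁⟩ := (noethGabrielOrd_limit_iff ho _).1 h₁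
          obtain ⟨b, hb, h₃⟩ := (noethGabrielOrd_limit_iff ho _).1 h₃
          have hm := ih (max a b) (max_lt ha hb)
          have := hm.1
          exact (noethGabrielOrd_limit_iff ho _).2 ⟨max a b, max_lt ha hb,
            ObjectProperty.prop_X₂_of_shortExact _ hS (hm.2 a (le_max_left a b) _ h₁)
              (hm.2 b (le_max_right a b) _ h₃)⟩ }
    · intro o' h
      rcases h.lt_or_eq with h | rfl
      · exact fun M hM => (noethGabrielOrd_limit_iff ho _).2 ⟨o', h, hM⟩
      · exact le_rfl

instance noethGabrielOrd_isSerreClass (o : Ordinal.{v}) : (noethGabrielOrd C o).IsSerreClass :=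
  (noethGabrielOrd_isSerreClass_and_le o).1

theorem noethGabrielOrd_monotone : Monotone (noethGabrielOrd C) :=
  fun a b h => (noethGabrielOrd_isSerreClass_and_le b).2 a h

theorem exists_forall_noethGabrielOrd [Noetherian.{v, u, v} C] :
    ∃ o, ∀ M, noethGabrielOrd C o M := by
  refine exists_forall_of_monotone (T := SmallModel.{v} C) (equivSmallModel C).inverse.obj
    noethGabrielOrd_monotone fun o => ?_
  rw [or_iff_not_imp_left]
  intro h
  push Not at h
  obtain ⟨N, hN⟩ := h
  obtain ⟨S, hS, hS'⟩ := exists_finiteLengthMod_cokernel _ hN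
  have e := (equivSmallModel C).unitIso.app (cokernel S.arrow)
  refine ⟨(equivSmallModel C).functor.obj (cokernel S.arrow), fun h => hS ?_, ?_⟩
  · exact (noethGabrielOrd C o).prop_of_iso e.symm h
  · rw [noethGabrielOrd_add_one]
    exact (finiteLengthMod _).prop_of_iso e hS'

theorem exists_isNoethKGDim [Noetherian.{v, u, v} C] [HasExt.{w} C] (α : ASpec C) :
    ∃ d : Ordinal.{v}, IsNoethKGDim C d ∧ projDim α ≤ cprojDim α + ordinalToENat d := by
  obtain ⟨d, hd, hd'⟩ := exists_isLeast α (G := noethGabriel C) rfl exists_forall_noethGabrielOrd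
  refine ⟨d, hd, projDim_le_cprojDim_add noethGabrielOrd_zero noethGabrielOrd_add_one
    noethGabrielOrd_isSerreClass ?_ hd'⟩
  intro P _ n hP hc N hN i hi
  exact subsingleton_of_finiteLengthMod hP hc hN hi

end Noetherian

/-! ### Locally noetherian Grothendieck categories -/

section Gabriel

variable {C : Type u} [Category.{v} C] [Abelian C]

theorem le_localizingClosure (Q : ObjectProperty C) : Q ≤ localizingClosure Q :=
  fun _ hM _ _ hQ => hQ _ hM

theorem localizingClosure_isLocalizing (Q : ObjectProperty C) :
    IsLocalizing (localizingClosure Q) where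
  isSerreClass :=
    { exists_zero := ⟨_, isZero_zero C, fun P hP _ =>
        have := hP.isSerreClass
        P.prop_of_isZero (isZero_zero C)⟩
      prop_of_mono := fun f _ h P hP hQ =>
        have := hP.isSerreClass
        P.prop_of_mono f (h P hP hQ)
      prop_of_epi := fun f _ h P hP hQ =>
        have := hP.isSerreClass
        P.prop_of_epi f (h P hP hQ)
      prop_X₂_of_shortExact := fun hS h₁ h₃ P hP hQ =>
        have := hP.isSerreClass
        P.prop_X₂_of_shortExact hS (h₁ P hP hQ) (h₃ P hP hQ) }
  isClosedUnderCoproducts ι := ⟨fun _ hM P hP hQ =>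
    have := hP.isClosedUnderCoproducts ι
    P.colimitsOfShape_le _ _
      (ObjectProperty.colimitsOfShape_monotone _ (fun _ h => h P hP hQ) _ hM)⟩

theorem gabrielOrd_zero : gabrielOrd C 0 = localizingClosure (finiteLengthMod IsZero) :=
  Ordinal.limitRecOn_zero ..

theorem gabrielOrd_add_one (o : Ordinal.{v}) :
    gabrielOrd C (o + 1) = localizingClosure (finiteLengthMod (gabrielOrd C o)) :=
  Ordinal.limitRecOn_add_one ..

theorem gabrielOrd_limit {o : Ordinal.{v}} (ho : Order.IsSuccLimit o) :
    gabrielOrd C o = localizingClosure fun M => ∃ (o' : Ordinal.{v}) (_ : o' < o),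
      gabrielOrd C o' M :=
  Ordinal.limitRecOn_limit _ _ _ _ ho

theorem gabrielOrd_isLocalizing (o : Ordinal.{v}) : IsLocalizing (gabrielOrd C o) := by
  induction o using Ordinal.limitRecOn with
  | zero => rw [gabrielOrd_zero]; exact localizingClosure_isLocalizing _
  | add_one o _ => rw [gabrielOrd_add_one]; exact localizingClosure_isLocalizing _
  | limit o ho _ => rw [gabrielOrd_limit ho]; exact localizingClosure_isLocalizing _

instance gabrielOrd_isSerreClass (o : Ordinal.{v}) : (gabrielOrd C o).IsSerreClass :=
  (gabrielOrd_isLocalizing o).isSerreClass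

theorem gabrielOrd_monotone : Monotone (gabrielOrd C) := by
  refine monotone_of_le_add_one (fun o => ?_) fun o ho o' ho' => ?_
  · rw [gabrielOrd_add_one]
    exact (le_finiteLengthMod _).trans (le_localizingClosure _)
  · rw [gabrielOrd_limit ho]
    exact fun M hM => le_localizingClosure _ _ ⟨o', ho', hM⟩

theorem IsLocalizing.forall_of_isSeparating [HasCoproducts.{v} C] {P : ObjectProperty C}
    (hP : IsLocalizing P) {ι : Type v} {U : ι → C}
    (hU : (ObjectProperty.ofObj U).IsSeparating) (h : ∀ i, P (U i)) (M : C) : P M := by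
  have := hP.isSerreClass
  let f : (Σ i, U i ⟶ M) → C := fun x => U x.1
  have := hP.isClosedUnderCoproducts (Σ i, U i ⟶ M)
  have hf : P (∐ f) := P.prop_of_isColimit (colimit.isColimit (Discrete.functor f))
    fun x => h x.as.1
  let p : ∐ f ⟶ M := Sigma.desc fun x => x.2
  have : Epi p := by
    refine ⟨fun a b hab => hU _ _ ?_⟩
    rintro _ ⟨i⟩ g
    simpa [p] using Sigma.ι f ⟨i, g⟩ ≫= hab
  exact P.prop_of_epi p hf

variable [IsGrothendieckAbelian.{v} C]

/-- A proper localizing subcategory misses some generator, so the new objects can be taken among the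
quotients of generators, which form a small family. -/
theorem exists_forall_gabrielOrd (hG : HasNoetherianGenerators C) :
    ∃ o, ∀ M, gabrielOrd C o M := by
  obtain ⟨ι, U, hU, hsep⟩ := hG
  refine exists_forall_of_monotone (T := Σ i, Subobject (U i)) (fun x => cokernel x.2.arrow)
    gabrielOrd_monotone fun o => ?_
  rw [or_iff_not_imp_left]
  intro h
  obtain ⟨i, hi⟩ : ∃ i, ¬ gabrielOrd C o (U i) := by
    by_contra! h'
    exact h ((gabrielOrd_isLocalizing o).forall_of_isSeparating hsep h')
  have := hU i
  obtain ⟨S, hS, hS'⟩ := exists_finiteLengthMod_cokernel _ hi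
  refine ⟨⟨i, S⟩, hS, ?_⟩
  rw [gabrielOrd_add_one]
  exact le_localizingClosure _ _ hS'

theorem exists_isKGDim [HasExt.{w} C] (hG : HasNoetherianGenerators C) (α : ASpec C) :
    ∃ d : Ordinal.{v}, IsKGDim C d ∧ projDim α ≤ cprojDim α + ordinalToENat d := by
  obtain ⟨d, hd, hd'⟩ := exists_isLeast α (G := gabriel C) rfl (exists_forall_gabrielOrd hG)
  refine ⟨d, hd, projDim_le_cprojDim_add
    (S := fun P => localizingClosure (finiteLengthMod P)) gabrielOrd_zero gabrielOrd_add_one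
    gabrielOrd_isSerreClass ?_ hd'⟩
  intro P _ n hP hc N hN i hi
  have := (localizingClosure_isLocalizing (finiteLengthMod P)).isSerreClass
  refine subsingleton_of_isNoetherianObject hG fun X f _ _ => ?_
  exact subsingleton_of_finiteLengthMod hP hc
    (prop_of_localizingClosure hG _ (ObjectProperty.prop_of_mono _ f hN)) hi

end Gabriel

end AtomSpectrum

/-- The first part is about locally noetherian Grothendieck categories, the second about noetherian
abelian categories. As an atom exists, the category is nonzero and its Krull-Gabriel dimension is
not `-1`. The class `HasExt.{w} C` only chooses a universe `w` for the extension groups; it always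
holds for `w = max u v`. -/
theorem theorem5 :
    (∀ (G : Type u) [Category.{v} G] [Abelian G] [IsGrothendieckAbelian.{v} G] [HasExt.{w} G],
      AtomSpectrum.HasNoetherianGenerators G → ∀ α : AtomSpectrum.ASpec G,
        ∃ d : Ordinal.{v}, AtomSpectrum.IsKGDim G d ∧
          AtomSpectrum.projDim α ≤ AtomSpectrum.cprojDim α + AtomSpectrum.ordinalToENat d) ∧
    (∀ (A : Type u) [Category.{v} A] [Abelian A] [Noetherian.{v, u, v} A] [HasExt.{w} A]
      (α : AtomSpectrum.ASpec A),
        ∃ d : Ordinal.{v}, AtomSpectrum.IsNoethKGDim A d ∧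
          AtomSpectrum.projDim α ≤ AtomSpectrum.cprojDim α + AtomSpectrum.ordinalToENat d) := by
  exact ⟨fun G _ _ _ _ hG α => AtomSpectrum.exists_isKGDim hG α,
    fun A _ _ _ _ α => AtomSpectrum.exists_isNoethKGDim α⟩
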